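/- Number rows downwards and columns to the right, from $0$; the content of the square in row $r$, column $c$ is $c-r$. A \emph{semistandard domino tableau} $M$ is a sequence of Young diagrams $\lambda^{0}\subset\lambda^{1}\subset\dots\subset\lambda^{n}$ in which each difference $d_k=\lambda^{k}\setminus\lambda^{k-1}$ ($1\le k\le n$) is a domino (two adjacent squares), together with entries $e_1\le e_2\le\dots\le e_n$ in $\mathbb{N}=\{0,1,\dots\}$, such that whenever $k<l$ and $e_k=e_l$, the position (sum of the contents of the squares) of $d_k$ is strictly less than that of $d_l$. Its shape is $\lambda^n/\lambda^0$. It is \emph{Yamanouchi} if, when the entries of the dominoes are read by columns from right to left, each column from top to bottom, with a horizontal domino read only once, in the right one of its two columns, each initial part of the word so obtained contains, for every $i\ge0$, at least as many entries $i$ as entries $i+1$. For $i\in\{0,1\}$ let an $i$-diagonal be a diagonal (set of squares of constant content $j$) with $j\equiv i \pmod 2$. A diagonal is \emph{active} for a Young diagram $\lambda$ if it contains a square that can be added to or removed from $\lambda$ so as to give a Young diagram (there is at most one such square, called the corner on that diagonal); \emph{switching} the diagonal means adding, respectively removing, that square. (The generator $s_i$ acts on Young diagrams by switching all active $i$-diagonals.)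 A domino \emph{affects} the two $i$-diagonals next to the one of its two squares that does not lie on an $i$-diagonal. Dominoes $d_k,d_l$ with $k<l$ are \emph{linked for $s_i$} if some $i$-diagonal is affected by both and is active for all of $\lambda^{k},\dots,\lambda^{l-1}$. The \emph{chains for $s_i$} are the classes of dominoes under the equivalence relation generated by links. Moving a union $X$ of chains means: for each $m$, replace $\lambda^m$ by the Young diagram obtained by switching those $i$-diagonals that are affected by some $d_k\in X$ and are active for all of $\lambda^{k},\dots,\lambda^{m}$ (if $k\le m$), respectively for all of $\lambda^{m},\dots,\lambda^{k-1}$ (if $m<k$); the entries are kept. A chain is \emph{closed} if moving it leaves $\lambda^0$ and $\lambda^n$ unchanged. \textbf{Lemma.} Let $M$ be a Yamanouchi domino tableau, let $s\in\{s_0,s_1\}$, and let $S$ be the set of closed chains $C$ in $M$ for $s$ for which the sequence obtained from $M$ by moving $C$ is again a Yamanouchi domino tableau. Then for every subset $T\subseteq S$, the sequence obtained from $M$ by simultaneously moving all the chains in $T$ is also a Yamanouchi domino tableau. -/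

import Mathlib

namespace DominoTab

/-- The content (diagonal index) of the cell in row `c.1` and column `c.2`. Rows are counted
downwards and columns to the right, both from `0`. -/
def content (c : ℕ × ℕ) : ℤ := (c.2 : ℤ) - (c.1 : ℤ)

/-- `c` can be added to the Young diagram `Y`. -/
def IsAddable (Y : YoungDiagram) (c : ℕ × ℕ) : Prop := c ∉ Y ∧ ∀ b, b < c → b ∈ Y

/-- `c` can be removed from the Young diagram `Y`. -/
def IsRemovable (Y : YoungDiagram) (c : ℕ × ℕ) : Prop := c ∈ Y ∧ ∀ b, c < b → b ∉ Y

/-- The diagonal `j` carries an addable or a removable cell of `Y`. In terms of the edge sequence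
of `Y`: the two successive edges of the boundary that meet on this diagonal are different. -/
def HasCorner (Y : YoungDiagram) (j : ℤ) : Prop :=
  ∃ c, content c = j ∧ (IsAddable Y c ∨ IsRemovable Y c)

/-- `c` lies on one of the diagonals in `J`, and this diagonal has the parity `s`. -/
def OnDiag (s : ZMod 2) (J : Set ℤ) (c : ℕ × ℕ) : Prop :=
  content c ∈ J ∧ ((content c : ℤ) : ZMod 2) = s

/-- The cells of `Y` after its corners on the given diagonals have been switched. -/
def FlipMem (s : ZMod 2) (J : Set ℤ) (Y : YoungDiagram) (c : ℕ × ℕ) : Prop :=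
  (c ∈ Y ∧ ¬ (IsRemovable Y c ∧ OnDiag s J c)) ∨ (IsAddable Y c ∧ OnDiag s J c)

theorem flipMem_of_le {s : ZMod 2} {J : Set ℤ} {Y : YoungDiagram} {a b : ℕ × ℕ}
    (hab : a ≤ b) (hb : FlipMem s J Y b) : FlipMem s J Y a := by
  rcases eq_or_lt_of_le hab with rfl | hlt
  · exact hb
  rcases hb with ⟨hbY, -⟩ | ⟨⟨hbY, hadd⟩, hbJ, hbs⟩
  · exact Or.inl ⟨Y.isLowerSet hab hbY, fun h => h.1.2 b hlt hbY⟩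
  · refine Or.inl ⟨hadd a hlt, ?_⟩
    rintro ⟨⟨_, hrem⟩, _, has⟩
    obtain ⟨a1, a2⟩ := a
    obtain ⟨b1, b2⟩ := b
    have key : ∀ c : ℕ × ℕ, (a1, a2) < c → c < (b1, b2) → False :=
      fun c h1 h2 => hrem c h1 (hadd c h2)
    have h1 : a1 ≤ b1 := hab.1
    have h2 : a2 ≤ b2 := hab.2
    have hne : ¬ (a1 = b1 ∧ a2 = b2) := by
      rintro ⟨rfl, rfl⟩
      exact lt_irrefl _ hlt
    have hodd : (b2 : ℤ) - b1 - (a2 - a1) = 1 ∨ (b2 : ℤ) - b1 - (a2 - a1) = -1 := by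
      by_contra hcon
      rcases lt_or_ge a1 b1 with h | h
      · apply key (a1 + 1, a2)
        · exact Prod.mk_lt_mk.mpr (Or.inl ⟨by omega, by omega⟩)
        · exact Prod.mk_lt_mk.mpr (by omega)
      · apply key (a1, a2 + 1)
        · exact Prod.mk_lt_mk.mpr (Or.inr ⟨by omega, by omega⟩)
        · exact Prod.mk_lt_mk.mpr (by omega)
    have hz : (((b2 : ℤ) - b1 - (a2 - a1) : ℤ) : ZMod 2) = 0 := by
      have e1 : (((b2 : ℤ) - b1 : ℤ) : ZMod 2) = s := hbs
      have e2 : (((a2 : ℤ) - a1 : ℤ) : ZMod 2) = s := has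
      rw [Int.cast_sub, e1, e2, sub_self]
    rw [ZMod.intCast_zmod_eq_zero_iff_dvd] at hz
    push_cast at hz
    omega

/-- A box that contains `Y` and all its addable cells. -/
def box (Y : YoungDiagram) : Finset (ℕ × ℕ) :=
  insert (0, 0) (Y.cells ∪ Y.cells.image (fun c => (c.1 + 1, c.2)) ∪
    Y.cells.image (fun c => (c.1, c.2 + 1)))

theorem mem_box_of_flipMem {s : ZMod 2} {J : Set ℤ} {Y : YoungDiagram} {c : ℕ × ℕ}
    (h : FlipMem s J Y c) : c ∈ box Y := by
  obtain ⟨i, j⟩ := c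
  rcases h with ⟨h, -⟩ | ⟨⟨_, h⟩, -⟩
  · simp [box, h]
  · rcases i with _ | i
    · rcases j with _ | j
      · simp [box]
      · have := h (0, j) (Prod.mk_lt_mk.mpr (by omega))
        simp [box, this]
    · have := h (i, j) (Prod.mk_lt_mk.mpr (by omega))
      simp [box, this]

open Classical in
/-- Switch the corners of `Y` on the diagonals that have parity `s` and lie in `J`: an addable
cell on such a diagonal is added, a removable one is removed. For `J = Set.univ` this is the
action of the generator `s` of the affine symmetric group on partitions: `s = 0` exchanges the
two edges at each even diagonal, and `s = 1` those at each odd diagonal. -/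
noncomputable def flip (s : ZMod 2) (J : Set ℤ) (Y : YoungDiagram) : YoungDiagram where
  cells := (box Y).filter (FlipMem s J Y)
  isLowerSet := by
    intro b a hab hb
    have hb' := (Finset.mem_filter.mp (Finset.mem_coe.mp hb)).2
    have ha := flipMem_of_le hab hb'
    exact Finset.mem_coe.mpr (Finset.mem_filter.mpr ⟨mem_box_of_flipMem ha, ha⟩)

open Classical in
theorem mem_flip {s : ZMod 2} {J : Set ℤ} {Y : YoungDiagram} {c : ℕ × ℕ} :
    c ∈ flip s J Y ↔ FlipMem s J Y c := by
  rw [← YoungDiagram.mem_cells, flip, Finset.mem_filter]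
  exact ⟨fun h => h.2, fun h => ⟨mem_box_of_flipMem h, h⟩⟩

/-- A pair of horizontally or vertically adjacent cells. -/
def IsDomino (d : Finset (ℕ × ℕ)) : Prop :=
  ∃ i j : ℕ, d = {(i, j), (i, j + 1)} ∨ d = {(i, j), (i + 1, j)}

/-- The sum of the contents of the cells of `d`. For dominoes it orders by position along the
boundary, from the lower left to the upper right. -/
def pos (d : Finset (ℕ × ℕ)) : ℤ := ∑ c ∈ d, content c

/-- Raw data for a domino tableau with `n` dominoes: the successive Young diagrams, from the inner
shape `shape 0` to the outer shape `shape (Fin.last n)`, and the entry given to each step. -/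
structure Filling (n : ℕ) where
  shape : Fin (n + 1) → YoungDiagram
  entry : Fin n → ℕ

namespace Filling

variable {n : ℕ}

/-- The set of cells added in step `k`. -/
def domino (M : Filling n) (k : Fin n) : Finset (ℕ × ℕ) :=
  (M.shape k.succ).cells \ (M.shape k.castSucc).cells

/-- Semistandard domino tableaux of skew shape: a skew shape is filled up by dominoes with entries
that weakly increase, where dominoes with equal entries come in order of increasing position.
(The dominoes with equal entry thus form a horizontal strip of dominoes; the order in which the
dominoes are listed is the standardisation of the tableau, so each tableau occurs just once.) -/
structure IsSemistandard (M : Filling n) : Prop where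
  le_step : ∀ k : Fin n, M.shape k.castSucc ≤ M.shape k.succ
  isDomino : ∀ k : Fin n, IsDomino (M.domino k)
  entry_mono : ∀ k l : Fin n, k ≤ l → M.entry k ≤ M.entry l
  pos_lt : ∀ k l : Fin n, k < l → M.entry k = M.entry l → pos (M.domino k) < pos (M.domino l)

/-- The (rightmost) column of the domino `k`. -/
def col (M : Filling n) (k : Fin n) : ℕ := (M.domino k).sup Prod.snd

/-- The (bottom) row of the domino `k`. -/
def row (M : Filling n) (k : Fin n) : ℕ := (M.domino k).sup Prod.fst

/-- The domino `l` is read before the domino `k`, or `l = k`. Columns are read from right to left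
and each from top to bottom; a horizontal domino is read when it is first met, in the right one
of its two columns. -/
def ReadUpTo (M : Filling n) (k l : Fin n) : Prop :=
  M.col k < M.col l ∨ (M.col l = M.col k ∧ M.row l ≤ M.row k)

open Classical in
/-- The number of entries `i` among those read up to and including the domino `k`. -/
noncomputable def readCount (M : Filling n) (k : Fin n) (i : ℕ) : ℕ :=
  (Finset.univ.filter fun l : Fin n => M.ReadUpTo k l ∧ M.entry l = i).card

/-- Yamanouchi domino tableaux: semistandard domino tableaux whose reading is a lattice
permutation: each initial part of it contains at least as many entries `i` as entries `i + 1`. -/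
structure IsYamanouchi (M : Filling n) : Prop where
  isSemistandard : M.IsSemistandard
  lattice : ∀ (k : Fin n) (i : ℕ), M.readCount k (i + 1) ≤ M.readCount k i

/-- The diagonal `j` of parity `s` is one of the two such diagonals whose edges are affected by the
domino `k`: they are adjacent to the cell of the domino that is not on a diagonal of parity `s`. -/
def Touches (M : Filling n) (s : ZMod 2) (k : Fin n) (j : ℤ) : Prop :=
  (j : ZMod 2) = s ∧ ∃ c ∈ M.domino k, |content c - j| = 1

/-- All Young diagrams from index `a` to index `b` have a corner on the diagonal `j`. -/
def Active (M : Filling n) (j : ℤ) (a b : Fin (n + 1)) : Prop :=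
  ∀ m, a ≤ m → m ≤ b → HasCorner (M.shape m) j

/-- The dominoes `k < l` are directly linked: some diagonal of parity `s` is affected by both, and
carries a corner at all times between them. (Switching this corner, at all these times,
necessarily involves both of the dominoes.) -/
def Linked (M : Filling n) (s : ZMod 2) (k l : Fin n) : Prop :=
  k < l ∧ ∃ j : ℤ, M.Touches s k j ∧ M.Touches s l j ∧ M.Active j k.succ l.castSucc

/-- The chains for `s`: the sets of dominoes that are connected by links. -/
def IsChain (M : Filling n) (s : ZMod 2) (C : Set (Fin n)) : Prop :=
  ∃ k, C = {l | Relation.EqvGen (M.Linked s) k l}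

/-- The diagonals on which the corner of the Young diagram with index `m` is switched when the set
`X` of dominoes is moved: those that carry a corner at all times between `m` and some domino
of `X` that affects the diagonal. -/
def movedDiags (M : Filling n) (s : ZMod 2) (X : Set (Fin n)) (m : Fin (n + 1)) : Set ℤ :=
  {j | ∃ k ∈ X, M.Touches s k j ∧
    ((k.castSucc < m ∧ M.Active j k.succ m) ∨ (m ≤ k.castSucc ∧ M.Active j m k.castSucc))}

/-- The result of moving all dominoes in `X`, a union of chains for `s`; entries are kept. -/
noncomputable def move (M : Filling n) (s : ZMod 2) (X : Set (Fin n)) : Filling n where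
  shape m := flip s (M.movedDiags s X m) (M.shape m)
  entry := M.entry

/-- The closed chains for `s`: those for which moving them changes neither the inner nor the
outer shape of the tableau. -/
def IsClosedChain (M : Filling n) (s : ZMod 2) (C : Set (Fin n)) : Prop :=
  M.IsChain s C ∧ (M.move s C).shape 0 = M.shape 0 ∧
    (M.move s C).shape (Fin.last n) = M.shape (Fin.last n)

/-- The closed chains for `s` for which the tableau obtained by moving that chain alone is a
Yamanouchi domino tableau. -/
def goodChains (M : Filling n) (s : ZMod 2) : Set (Set (Fin n)) :=
  {C | M.IsClosedChain s C ∧ (M.move s C).IsYamanouchi}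

end Filling

end DominoTab

namespace DominoTab

/-! Encode a Young diagram by its boundary height on each diagonal. Adjacent heights differ by one;
a corner is a local extremum of the height, and switching reflects it; adding a domino raises two
adjacent heights by 2. Give each domino as base `m` the content of its square off the `s`-diagonals,
so that its position is `2 * m + 1` or `2 * m - 1`. Moving a union of chains exchanges these two
values for exactly the dominoes in it and fixes all other positions
(`IsLinkClosed.isDominoStep_move`, `IsSemistandard.exists_base`).

For semistandard tableaux, the Yamanouchi property can be read off from entries and positions alone:
for all `i` and `p`, at most as many `i + 1` lie at positions `≥ p` as `i` at positions `> p`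
(`IsYamanouchi.posLattice`, `IsSemistandard.isYamanouchi`).

All bases have the same parity, so dominoes with different bases never change their order. Dominoes
with equal entry and equal base cannot lie in a good chain, since moving it would make their
positions coincide or reverse them. Hence a simultaneous move stays semistandard. Each lattice
inequality to be checked involves one base and one entry for which a move matters, so at most one
domino of the moved chains; the inequality follows from that of `M`, or of `M` with the single chain
of this domino moved. -/

/-! ### Boundary heights of Young diagrams -/

theorem exists_notMem_diag (Y : YoungDiagram) (j : ℤ) :
    ∃ q : ℕ, (q + (-j).toNat, q + j.toNat) ∉ Y := by
  obtain ⟨c, hc⟩ := Y.exists_notMem_row (-j).toNat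
  exact ⟨c, fun h => hc (Y.isLowerSet (Prod.mk_le_mk.mpr ⟨by omega, by omega⟩) h)⟩

open Classical in
/-- The height of the boundary of `Y` on the diagonal `j`: the cells `(r, c)` of `Y` on this
diagonal are those with `r + c < height Y j`. -/
noncomputable def height (Y : YoungDiagram) (j : ℤ) : ℤ :=
  -- The first cell of the diagonal has `r + c = |j|`, and each further cell adds 2.
  2 * (Nat.find (exists_notMem_diag Y j) : ℤ) + |j|

theorem abs_le_height (Y : YoungDiagram) (j : ℤ) : |j| ≤ height Y j := by
  unfold height; omega

theorem height_emod_two (Y : YoungDiagram) (j : ℤ) : height Y j % 2 = j % 2 := by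
  unfold height
  rcases abs_choice j with h | h <;> omega

open Classical in
theorem mem_iff_lt_height {Y : YoungDiagram} {r c : ℕ} :
    (r, c) ∈ Y ↔ (r : ℤ) + c < height Y (c - r) := by
  set j : ℤ := c - r with hj
  have hr : r = min r c + (-j).toNat := by omega
  have hc : c = min r c + j.toNat := by omega
  have h1 : (r, c) ∈ Y ↔ min r c < Nat.find (exists_notMem_diag Y j) := by
    rw [Nat.lt_find_iff]
    constructor
    · intro h m hm
      rw [not_not]
      exact Y.isLowerSet (Prod.mk_le_mk.mpr ⟨by omega, by omega⟩) h
    · intro h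
      have := h _ le_rfl
      rw [not_not, ← hr, ← hc] at this
      exact this
  rw [h1]
  unfold height
  rcases abs_cases j with h | h <;> omega

theorem exists_cell {j v : ℤ} (h : |j| ≤ v) (h2 : v % 2 = j % 2) :
    ∃ r c : ℕ, (r : ℤ) + c = v ∧ (c : ℤ) - r = j := by
  rw [abs_le] at h
  exact ⟨((v - j) / 2).toNat, ((v + j) / 2).toNat, by omega, by omega⟩

theorem mem_iff_of_eq {Y : YoungDiagram} {r c : ℕ} {j v : ℤ} (hv : (r : ℤ) + c = v)
    (hj : (c : ℤ) - r = j) : (r, c) ∈ Y ↔ v < height Y j := by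
  rw [mem_iff_lt_height, hv, hj]

/-- The parities of the two heights differ, and a gap of 3 or more would put a cell in `Y` without
its left or upper neighbour. -/
theorem height_succ (Y : YoungDiagram) (j : ℤ) :
    height Y (j + 1) = height Y j + 1 ∨ height Y (j + 1) = height Y j - 1 := by
  have p1 := height_emod_two Y j
  have p2 := height_emod_two Y (j + 1)
  by_contra hcon
  rcases lt_or_ge (height Y j) (height Y (j + 1)) with h | h
  · obtain ⟨r, c, hv, hj⟩ := exists_cell (abs_le_height Y j) p1
    have h1 : (r, c + 1) ∈ Y :=
      (mem_iff_of_eq (v := height Y j + 1) (j := j + 1) (by omega) (by omega)).2 (by omega)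
    have h2 : (r, c) ∈ Y := Y.isLowerSet (Prod.mk_le_mk.mpr ⟨by omega, by omega⟩) h1
    exact lt_irrefl _ ((mem_iff_of_eq hv hj).1 h2)
  · obtain ⟨r, c, hv, hj⟩ := exists_cell (abs_le_height Y (j + 1)) p2
    have h1 : (r + 1, c) ∈ Y :=
      (mem_iff_of_eq (v := height Y (j + 1) + 1) (j := j) (by omega) (by omega)).2 (by omega)
    have h2 : (r, c) ∈ Y := Y.isLowerSet (Prod.mk_le_mk.mpr ⟨by omega, by omega⟩) h1
    exact lt_irrefl _ ((mem_iff_of_eq hv hj).1 h2)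

theorem height_pred (Y : YoungDiagram) (j : ℤ) :
    height Y (j - 1) = height Y j + 1 ∨ height Y (j - 1) = height Y j - 1 := by
  have := height_succ Y (j - 1)
  rw [sub_add_cancel] at this
  omega

theorem isAddable_iff {Y : YoungDiagram} {r c : ℕ} :
    IsAddable Y (r, c) ↔ height Y (c - r) = r + c ∧ height Y (c - r - 1) = r + c + 1 ∧
      height Y (c - r + 1) = r + c + 1 := by
  have s1 := height_succ Y (c - r)
  have s2 := height_pred Y (c - r)
  have p := height_emod_two Y (c - r)
  have a1 := abs_le.1 (abs_le_height Y (c - r - 1))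
  have a2 := abs_le.1 (abs_le_height Y (c - r + 1))
  constructor
  · rintro ⟨h1, h2⟩
    rw [mem_iff_lt_height] at h1
    have h3 : (r : ℤ) + c - 1 < height Y (c - r - 1) := by
      rcases Nat.eq_zero_or_pos c with h | h
      · omega
      · have := h2 (r, c - 1) (Prod.mk_lt_mk.mpr (by omega))
        rw [mem_iff_of_eq (j := (c : ℤ) - r - 1) rfl (by omega)] at this
        omega
    have h4 : (r : ℤ) + c - 1 < height Y (c - r + 1) := by
      rcases Nat.eq_zero_or_pos r with h | h
      · omega
      · have := h2 (r - 1, c) (Prod.mk_lt_mk.mpr (by omega))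
        rw [mem_iff_of_eq (j := (c : ℤ) - r + 1) rfl (by omega)] at this
        omega
    omega
  · rintro ⟨h1, h2, h3⟩
    refine ⟨by rw [mem_iff_lt_height]; omega, ?_⟩
    rintro ⟨r', c'⟩ hlt
    rw [Prod.mk_lt_mk] at hlt
    rcases lt_or_ge c' c with h | h
    · obtain ⟨c, rfl⟩ : ∃ d, c = d + 1 := ⟨c - 1, by omega⟩
      have : (r, c) ∈ Y := by
        rw [mem_iff_of_eq (j := ((c + 1 : ℕ) : ℤ) - r - 1) rfl (by push_cast; ring), h2]
        push_cast; omega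
      exact Y.isLowerSet (Prod.mk_le_mk.mpr ⟨by omega, by omega⟩) this
    · obtain ⟨r, rfl⟩ : ∃ d, r = d + 1 := ⟨r - 1, by omega⟩
      have : (r, c) ∈ Y := by
        rw [mem_iff_of_eq (j := (c : ℤ) - ((r + 1 : ℕ) : ℤ) + 1) rfl (by push_cast; ring), h3]
        push_cast; omega
      exact Y.isLowerSet (Prod.mk_le_mk.mpr ⟨by omega, by omega⟩) this

theorem isRemovable_iff {Y : YoungDiagram} {r c : ℕ} :
    IsRemovable Y (r, c) ↔ height Y (c - r) = r + c + 2 ∧ height Y (c - r - 1) = r + c + 1 ∧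
      height Y (c - r + 1) = r + c + 1 := by
  have s1 := height_succ Y (c - r)
  have s2 := height_pred Y (c - r)
  have p := height_emod_two Y (c - r)
  have e1 : (r + 1, c) ∈ Y ↔ (r : ℤ) + c + 1 < height Y (c - r - 1) :=
    mem_iff_of_eq (by push_cast; ring) (by push_cast; ring)
  have e2 : (r, c + 1) ∈ Y ↔ (r : ℤ) + c + 1 < height Y (c - r + 1) :=
    mem_iff_of_eq (by push_cast; ring) (by push_cast; ring)
  constructor
  · rintro ⟨h1, h2⟩
    rw [mem_iff_lt_height] at h1
    have h3 := h2 (r + 1, c) (Prod.mk_lt_mk.mpr (by omega))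
    have h4 := h2 (r, c + 1) (Prod.mk_lt_mk.mpr (by omega))
    rw [e1] at h3
    rw [e2] at h4
    omega
  · rintro ⟨h1, h2, h3⟩
    refine ⟨by rw [mem_iff_lt_height]; omega, ?_⟩
    rintro ⟨r', c'⟩ hlt hmem
    rw [Prod.mk_lt_mk] at hlt
    rcases lt_or_ge c c' with h | h
    · have := e2.1 (Y.isLowerSet (Prod.mk_le_mk.mpr ⟨by omega, by omega⟩) hmem)
      omega
    · have := e1.1 (Y.isLowerSet (Prod.mk_le_mk.mpr ⟨by omega, by omega⟩) hmem)
      omega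

/-- Corners are the local extrema of the height: a minimum is addable, a maximum removable. -/
theorem hasCorner_iff {Y : YoungDiagram} {j : ℤ} :
    HasCorner Y j ↔ height Y (j - 1) = height Y (j + 1) := by
  constructor
  · rintro ⟨⟨r, c⟩, rfl, h⟩
    rw [isAddable_iff, isRemovable_iff] at h
    simp only [content]
    omega
  · intro h
    have a0 := abs_le_height Y j
    have a1 := abs_le.1 (abs_le_height Y (j - 1))
    have a2 := abs_le.1 (abs_le_height Y (j + 1))
    have p := height_emod_two Y j
    rcases height_succ Y j with h1 | h1
    · obtain ⟨r, c, hv, hj⟩ := exists_cell a0 p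
      refine ⟨(r, c), hj, Or.inl (isAddable_iff.2 ?_)⟩
      rw [hj]
      omega
    · obtain ⟨r, c, hv, hj⟩ := exists_cell (j := j) (v := height Y j - 2)
        (abs_le.2 ⟨by omega, by omega⟩) (by omega)
      refine ⟨(r, c), hj, Or.inr (isRemovable_iff.2 ?_)⟩
      rw [hj]
      omega

theorem height_eq_of_mem_iff {Y : YoungDiagram} {j v : ℤ} (hv : |j| ≤ v) (hp : v % 2 = j % 2)
    (h : ∀ r c : ℕ, (c : ℤ) - r = j → ((r, c) ∈ Y ↔ (r : ℤ) + c < v)) : height Y j = v := by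
  rcases lt_trichotomy (height Y j) v with hlt | heq | hlt
  · obtain ⟨r, c, h1, h2⟩ := exists_cell (abs_le_height Y j) (height_emod_two Y j)
    have := (mem_iff_of_eq h1 h2).1 ((h r c h2).2 (by omega))
    omega
  · exact heq
  · obtain ⟨r, c, h1, h2⟩ := exists_cell hv hp
    have := (h r c h2).1 ((mem_iff_of_eq h1 h2).2 hlt)
    omega

-- Without a corner on `j` the height there is the mean of its neighbours, so the reflection formula
-- is then the identity and needs no case for activity.
open Classical in
theorem height_flip (s : ZMod 2) (J : Set ℤ) (Y : YoungDiagram) (j : ℤ) :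
    height (flip s J Y) j = if j ∈ J ∧ (j : ZMod 2) = s
      then height Y (j - 1) + height Y (j + 1) - height Y j else height Y j := by
  have s1 := height_succ Y j
  have s2 := height_pred Y j
  have a0 := abs_le.1 (abs_le_height Y j)
  have a1 := abs_le.1 (abs_le_height Y (j - 1))
  have a2 := abs_le.1 (abs_le_height Y (j + 1))
  have p := height_emod_two Y j
  split_ifs with hJ
  · refine height_eq_of_mem_iff (abs_le.2 ⟨by omega, by omega⟩) (by omega) ?_
    rintro r c rfl
    have hd : OnDiag s J (r, c) := hJ
    rw [mem_flip, FlipMem, isAddable_iff, isRemovable_iff, mem_iff_lt_height]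
    simp only [hd, and_true]
    omega
  · refine height_eq_of_mem_iff (abs_le.2 ⟨by omega, by omega⟩) p ?_
    rintro r c rfl
    have hd : ¬ OnDiag s J (r, c) := hJ
    rw [mem_flip, FlipMem, mem_iff_lt_height]
    simp only [hd, and_false, not_false_eq_true, and_true, or_false]

/-! ### Domino steps in terms of heights -/

/-- `Y'` arises from `Y` by adding a domino with cells on the diagonals `a` and `a + 1`. -/
def IsDominoStep (Y Y' : YoungDiagram) (a : ℤ) : Prop :=
  ∀ j, height Y' j = height Y j + if j = a ∨ j = a + 1 then 2 else 0

/-- The two new cells lie on different diagonals, so a height grows by at most 2, and by parity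
exactly by 0 or 2. -/
theorem isDominoStep_of_sdiff {Y Y' : YoungDiagram} (hle : Y ≤ Y') {a : ℤ} {x y : ℕ × ℕ}
    (hd : Y'.cells \ Y.cells = {x, y}) (hx : content x = a) (hy : content y = a + 1) :
    IsDominoStep Y Y' a := by
  have hmem : ∀ r c : ℕ, ((r, c) ∈ Y' ∧ (r, c) ∉ Y) ↔ ((r, c) = x ∨ (r, c) = y) := by
    intro r c
    rw [← YoungDiagram.mem_cells, ← YoungDiagram.mem_cells, ← Finset.mem_sdiff, hd]
    simp
  have hc : ∀ r c r' c' : ℕ, ((r, c) ∈ Y' ∧ (r, c) ∉ Y) → ((r', c') ∈ Y' ∧ (r', c') ∉ Y) →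
      (c : ℤ) - r = c' - r' → (r, c) = (r', c') := by
    intro r c r' c' h h' he
    rw [hmem] at h h'
    rcases h with rfl | rfl <;> rcases h' with h' | h'
    · exact h'.symm
    · subst h'; simp only [content] at hx hy; omega
    · subst h'; simp only [content] at hx hy; omega
    · exact h'.symm
  intro j
  have p := height_emod_two Y j
  have p' := height_emod_two Y' j
  have a0 := abs_le_height Y j
  have key : ∀ v, |j| ≤ v → v % 2 = j % 2 → v < height Y j → v < height Y' j := by
    intro v h1 h2 h3
    obtain ⟨r, c, hv, hj⟩ := exists_cell h1 h2
    exact (mem_iff_of_eq hv hj).1 (hle ((mem_iff_of_eq hv hj).2 h3))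
  have hge : height Y j ≤ height Y' j := by
    by_contra hcon
    have := key (height Y' j) (abs_le_height Y' j) p' (by omega)
    omega
  have hle2 : height Y' j ≤ height Y j + 2 := by
    by_contra hcon
    obtain ⟨r, c, hv, hj⟩ := exists_cell a0 p
    obtain ⟨r', c', hv', hj'⟩ := exists_cell (j := j) (v := height Y j + 2) (by omega) (by omega)
    have := hc r c r' c' ⟨(mem_iff_of_eq hv hj).2 (by omega), mt (mem_iff_of_eq hv hj).1 (by omega)⟩
      ⟨(mem_iff_of_eq hv' hj').2 (by omega), mt (mem_iff_of_eq hv' hj').1 (by omega)⟩ (by omega)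
    rw [Prod.mk.injEq] at this
    omega
  have hcell : ∀ z : ℕ × ℕ, (z = x ∨ z = y) → content z = j → height Y j < height Y' j := by
    rintro ⟨r, c⟩ hz hj
    have := (hmem r c).2 hz
    rw [mem_iff_of_eq rfl hj, mem_iff_of_eq rfl hj] at this
    omega
  split_ifs with h
  · have : height Y j < height Y' j := by
      rcases h with rfl | rfl
      · exact hcell x (Or.inl rfl) hx
      · exact hcell y (Or.inr rfl) hy
    omega
  · by_contra hcon
    obtain ⟨r, c, hv, hj⟩ := exists_cell a0 p
    rcases (hmem r c).1 ⟨(mem_iff_of_eq hv hj).2 (by omega), mt (mem_iff_of_eq hv hj).1 (by omega)⟩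
      with rfl | rfl
    · exact h (Or.inl (hj.symm.trans hx))
    · exact h (Or.inr (hj.symm.trans hy))

theorem exists_isDominoStep {Y Y' : YoungDiagram} (hle : Y ≤ Y')
    (hd : IsDomino (Y'.cells \ Y.cells)) : ∃ a, IsDominoStep Y Y' a := by
  obtain ⟨r, c, h | h⟩ := hd
  · exact ⟨_, isDominoStep_of_sdiff hle h rfl (by simp [content]; ring)⟩
  · rw [Finset.pair_comm] at h
    exact ⟨_, isDominoStep_of_sdiff hle h rfl (by simp only [content]; push_cast; ring)⟩

theorem IsDominoStep.le {Y Y' : YoungDiagram} {a : ℤ} (h : IsDominoStep Y Y' a) : Y ≤ Y' := by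
  rintro ⟨r, c⟩ hrc
  change (r, c) ∈ Y at hrc
  rw [mem_iff_lt_height] at *
  have := h (c - r)
  split_ifs at this <;> omega

/-- The domino is horizontal if the height of `Y` rises from `a` to `a + 1`, and vertical if it
falls. -/
theorem IsDominoStep.exists_sdiff_eq {Y Y' : YoungDiagram} {a : ℤ} (h : IsDominoStep Y Y' a) :
    ∃ r c : ℕ, (Y'.cells \ Y.cells = {(r, c), (r, c + 1)} ∧ (c : ℤ) - r = a) ∨
      (Y'.cells \ Y.cells = {(r, c), (r + 1, c)} ∧ (c : ℤ) - r = a + 1) := by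
  have hmem : ∀ x y : ℕ, (x, y) ∈ Y'.cells \ Y.cells ↔
      ((y : ℤ) - x = a ∧ (x : ℤ) + y = height Y a) ∨
      ((y : ℤ) - x = a + 1 ∧ (x : ℤ) + y = height Y (a + 1)) := by
    intro x y
    rw [Finset.mem_sdiff, YoungDiagram.mem_cells, YoungDiagram.mem_cells, mem_iff_lt_height,
      mem_iff_lt_height, h]
    have p := height_emod_two Y (y - x)
    constructor
    · rintro ⟨h1, h2⟩
      split_ifs at h1 with h3
      · rcases h3 with h3 | h3
        · rw [h3] at h1 h2 p; left; omega
        · rw [h3] at h1 h2 p; right; omega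
      · omega
    · rintro (⟨h1, h2⟩ | ⟨h1, h2⟩) <;> rw [h1] <;> simp <;> omega
  rcases height_succ Y a with h1 | h1
  · obtain ⟨r, c, hv, hj⟩ := exists_cell (abs_le_height Y a) (height_emod_two Y a)
    refine ⟨r, c, Or.inl ⟨?_, hj⟩⟩
    ext ⟨x, y⟩
    rw [hmem]
    simp only [Finset.mem_insert, Finset.mem_singleton, Prod.mk.injEq]
    omega
  · obtain ⟨r, c, hv, hj⟩ := exists_cell (abs_le_height Y (a + 1)) (height_emod_two Y (a + 1))
    refine ⟨r, c, Or.inr ⟨?_, hj⟩⟩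
    ext ⟨x, y⟩
    rw [hmem]
    simp only [Finset.mem_insert, Finset.mem_singleton, Prod.mk.injEq]
    omega

theorem IsDominoStep.isDomino {Y Y' : YoungDiagram} {a : ℤ} (h : IsDominoStep Y Y' a) :
    IsDomino (Y'.cells \ Y.cells) := by
  obtain ⟨r, c, ⟨h, -⟩ | ⟨h, -⟩⟩ := h.exists_sdiff_eq
  · exact ⟨r, c, Or.inl h⟩
  · exact ⟨r, c, Or.inr h⟩

theorem IsDominoStep.pos_sdiff {Y Y' : YoungDiagram} {a : ℤ} (h : IsDominoStep Y Y' a) :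
    pos (Y'.cells \ Y.cells) = 2 * a + 1 := by
  obtain ⟨r, c, ⟨h, hj⟩ | ⟨h, hj⟩⟩ := h.exists_sdiff_eq
  · rw [h, pos, Finset.sum_pair (by simp)]
    simp only [content]
    push_cast
    omega
  · rw [h, pos, Finset.sum_pair (by simp)]
    simp only [content]
    push_cast
    omega

theorem IsDominoStep.exists_content_iff {Y Y' : YoungDiagram} {a : ℤ} (h : IsDominoStep Y Y' a)
    (j : ℤ) : (∃ c ∈ Y'.cells \ Y.cells, content c = j) ↔ j = a ∨ j = a + 1 := by
  obtain ⟨r, c, ⟨h, hj⟩ | ⟨h, hj⟩⟩ := h.exists_sdiff_eq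
  · rw [h]
    simp only [content, Finset.mem_insert, Finset.mem_singleton, exists_eq_or_imp, exists_eq_left]
    push_cast
    omega
  · rw [h]
    simp only [content, Finset.mem_insert, Finset.mem_singleton, exists_eq_or_imp, exists_eq_left]
    push_cast
    omega

theorem exists_intCast_eq_iff (s : ZMod 2) :
    ∃ t : ℤ, ∀ j : ℤ, (j : ZMod 2) = s ↔ j % 2 = t % 2 := by
  obtain ⟨t, rfl⟩ := ZMod.intCast_surjective s
  exact ⟨t, fun j => ZMod.intCast_eq_intCast_iff' j t 2⟩

/-- Of the two neighbours of an affected diagonal only the base `m` is sure to gain; the other lies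
outside the domino. This makes the step create or destroy the corner on `j`. -/
theorem IsDominoStep.height_neighbors {Y Y' : YoungDiagram} {a m j : ℤ}
    (ha : IsDominoStep Y Y' a) (ham : a = m ∨ a = m - 1) (hj : j = m - 1 ∨ j = m + 1) :
    (height Y' (j - 1) = height Y (j - 1) + 2 ∧ height Y' (j + 1) = height Y (j + 1)) ∨
      (height Y' (j - 1) = height Y (j - 1) ∧ height Y' (j + 1) = height Y (j + 1) + 2) := by
  have e1 := ha (j - 1)
  have e2 := ha (j + 1)
  rcases hj with h | h
  · rw [if_neg (by omega)] at e1
    rw [if_pos (by omega)] at e2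
    exact Or.inr ⟨by omega, e2⟩
  · rw [if_pos (by omega)] at e1
    rw [if_neg (by omega)] at e2
    exact Or.inl ⟨e1, by omega⟩

/-! ### Links and the effect of moving chains -/

namespace Filling

variable {n : ℕ}

/-- `X` is a union of chains for `s`. -/
def IsLinkClosed (M : Filling n) (s : ZMod 2) (X : Set (Fin n)) : Prop :=
  ∀ k l, M.Linked s k l → (k ∈ X ↔ l ∈ X)

theorem isLinkClosed_of_isChain {M : Filling n} {s : ZMod 2} {C : Set (Fin n)}
    (h : M.IsChain s C) : M.IsLinkClosed s C := by
  obtain ⟨a, rfl⟩ := h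
  intro k l hkl
  exact ⟨fun h => h.trans _ _ _ (.rel _ _ hkl), fun h => h.trans _ _ _ (.symm _ _ (.rel _ _ hkl))⟩

theorem IsLinkClosed.sUnion {M : Filling n} {s : ZMod 2} {T : Set (Set (Fin n))}
    (h : ∀ C ∈ T, M.IsLinkClosed s C) : M.IsLinkClosed s (⋃₀ T) := by
  intro k l hkl
  simp only [Set.mem_sUnion]
  exact exists_congr fun C => and_congr_right fun hC => h C hC k l hkl

theorem hasCorner_of_mem_movedDiags {M : Filling n} {s : ZMod 2} {X : Set (Fin n)}
    {m : Fin (n + 1)} {j : ℤ} (h : j ∈ M.movedDiags s X m) : HasCorner (M.shape m) j := by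
  obtain ⟨k, -, -, ⟨h1, h2⟩ | ⟨h1, h2⟩⟩ := h
  · exact h2 m (by rw [Fin.le_def, Fin.val_succ]; exact h1) le_rfl
  · exact h2 m le_rfl h1

/-- An interval of activity ending at one side of step `k` extends across it, and `k` itself is not
a witness. -/
theorem mem_movedDiags_castSucc_iff_succ {M : Filling n} {s : ZMod 2} {X : Set (Fin n)}
    {k : Fin n} {j : ℤ} (ht : ¬ M.Touches s k j) (h1 : HasCorner (M.shape k.castSucc) j)
    (h2 : HasCorner (M.shape k.succ) j) :
    j ∈ M.movedDiags s X k.castSucc ↔ j ∈ M.movedDiags s X k.succ := by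
  refine exists_congr fun l => and_congr_right fun _ => and_congr_right fun hl => ?_
  have hne : (l : ℕ) ≠ k := fun h => ht (Fin.ext h ▸ hl)
  simp only [Active, Fin.lt_def, Fin.le_def, Fin.val_succ, Fin.val_castSucc]
  refine or_congr ?_ ?_
  · constructor
    · rintro ⟨h, ha⟩
      refine ⟨by omega, fun m hm hm' => ?_⟩
      rcases Nat.lt_or_ge k m with hlt | hge
      · rwa [show m = k.succ from Fin.ext (by rw [Fin.val_succ]; omega)]
      · exact ha m hm hge
    · rintro ⟨h, ha⟩
      exact ⟨by omega, fun m hm hm' => ha m hm (by omega)⟩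
  · constructor
    · rintro ⟨h, ha⟩
      exact ⟨by omega, fun m hm hm' => ha m (by omega) hm'⟩
    · rintro ⟨h, ha⟩
      refine ⟨by omega, fun m hm hm' => ?_⟩
      rcases Nat.lt_or_ge k m with hlt | hge
      · exact ha m hlt hm'
      · rwa [show m = k.castSucc from Fin.ext (by rw [Fin.val_castSucc]; omega)]

/-- The activity begins at step `k`, so any other witness is a later domino linked to `k`. -/
theorem IsLinkClosed.mem_movedDiags_succ_iff {M : Filling n} {s : ZMod 2} {X : Set (Fin n)}
    (hX : M.IsLinkClosed s X) {k : Fin n} {j : ℤ} (ht : M.Touches s k j)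
    (h1 : ¬ HasCorner (M.shape k.castSucc) j) (h2 : HasCorner (M.shape k.succ) j) :
    j ∈ M.movedDiags s X k.succ ↔ k ∈ X := by
  constructor
  · rintro ⟨l, hl, htl, ⟨h, ha⟩ | ⟨h, ha⟩⟩
    · have hle : (l : ℕ) ≤ k := by
        rw [Fin.lt_def, Fin.val_castSucc, Fin.val_succ] at h; omega
      rcases hle.lt_or_eq with hlt | heq
      · refine absurd (ha k.castSucc ?_ ?_) h1 <;>
          simp only [Fin.le_def, Fin.val_succ, Fin.val_castSucc] <;> omega
      · rwa [← Fin.ext heq]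
    · have hlt : k < l := by
        rw [Fin.le_def, Fin.val_castSucc, Fin.val_succ] at h; exact h
      exact (hX k l ⟨hlt, j, ht, htl, ha⟩).2 hl
  · intro hk
    refine ⟨k, hk, ht, Or.inl ⟨Fin.castSucc_lt_succ, fun m hm hm' => ?_⟩⟩
    rwa [le_antisymm hm' hm]

/-- The activity ends at step `k`, so any other witness is an earlier domino linked to `k`. -/
theorem IsLinkClosed.mem_movedDiags_castSucc_iff {M : Filling n} {s : ZMod 2} {X : Set (Fin n)}
    (hX : M.IsLinkClosed s X) {k : Fin n} {j : ℤ} (ht : M.Touches s k j)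
    (h1 : HasCorner (M.shape k.castSucc) j) (h2 : ¬ HasCorner (M.shape k.succ) j) :
    j ∈ M.movedDiags s X k.castSucc ↔ k ∈ X := by
  constructor
  · rintro ⟨l, hl, htl, ⟨h, ha⟩ | ⟨h, ha⟩⟩
    · have hlt : l < k := by
        rw [Fin.lt_def, Fin.val_castSucc, Fin.val_castSucc] at h; exact h
      exact (hX l k ⟨hlt, j, htl, ht, ha⟩).1 hl
    · have hle : (k : ℕ) ≤ l := h
      rcases hle.lt_or_eq with hlt | heq
      · refine absurd (ha k.succ ?_ ?_) h2 <;>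
          simp only [Fin.le_def, Fin.val_succ, Fin.val_castSucc] <;> omega
      · rwa [Fin.ext heq]
  · intro hk
    refine ⟨k, hk, ht, Or.inr ⟨le_rfl, fun m hm hm' => ?_⟩⟩
    rwa [le_antisymm hm' hm]

theorem touches_iff {M : Filling n} {s : ZMod 2} {k : Fin n} {a m j : ℤ}
    (ha : IsDominoStep (M.shape k.castSucc) (M.shape k.succ) a) (hm : ¬ (m : ZMod 2) = s)
    (ham : a = m ∨ a = m - 1) :
    M.Touches s k j ↔ (j : ZMod 2) = s ∧ (j = m - 1 ∨ j = m + 1) := by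
  obtain ⟨t, ht⟩ := exists_intCast_eq_iff s
  rw [Touches, ht]
  rw [ht] at hm
  have key : (∃ c ∈ M.domino k, |content c - j| = 1) ↔
      (a = j - 1 ∨ a = j + 1) ∨ (a + 1 = j - 1 ∨ a + 1 = j + 1) := by
    have h1 := ha.exists_content_iff (j - 1)
    have h2 := ha.exists_content_iff (j + 1)
    constructor
    · rintro ⟨c, hc, hcj⟩
      rcases (abs_eq zero_le_one).1 hcj with h | h
      · have := h2.1 ⟨c, hc, by omega⟩
        omega
      · have := h1.1 ⟨c, hc, by omega⟩
        omega
    · intro h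
      by_cases h' : j - 1 = a ∨ j - 1 = a + 1
      · obtain ⟨c, hc, hcj⟩ := h1.2 h'
        exact ⟨c, hc, by rw [hcj]; simp⟩
      · obtain ⟨c, hc, hcj⟩ := h2.2 (by omega)
        exact ⟨c, hc, by rw [hcj]; simp⟩
  rw [key]
  clear key
  omega

open Classical in
/-- Moving a union of chains turns the domino steps of the chains about their base diagonal `m`,
and leaves the other steps where they are. -/
theorem IsLinkClosed.isDominoStep_move {M : Filling n} {s : ZMod 2} {X : Set (Fin n)}
    (hX : M.IsLinkClosed s X) {k : Fin n} {a m : ℤ}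
    (ha : IsDominoStep (M.shape k.castSucc) (M.shape k.succ) a) (hm : ¬ (m : ZMod 2) = s)
    (ham : a = m ∨ a = m - 1) :
    IsDominoStep ((M.move s X).shape k.castSucc) ((M.move s X).shape k.succ)
      (if k ∈ X then 2 * m - 1 - a else a) := by
  intro j
  have htouch := touches_iff (j := j) ha hm ham
  obtain ⟨t, ht⟩ := exists_intCast_eq_iff s
  rw [ht] at hm
  have e0 := ha j
  have e1 := ha (j - 1)
  have e2 := ha (j + 1)
  simp only [move, height_flip]
  rw [ht] at htouch
  simp only [ht]
  by_cases hj : j % 2 = t % 2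
  swap
  -- Off the `s`-diagonals no height is switched, and both placements of the domino contain the
  -- diagonal `m`.
  · simp only [hj, and_false, if_false]
    rw [e0]
    congr 2
    split_ifs <;> apply propext <;> omega
  simp only [hj, and_true]
  by_cases hjm : j = m - 1 ∨ j = m + 1
  · have htj : M.Touches s k j := htouch.2 ⟨hj, hjm⟩
    have e12 := ha.height_neighbors ham hjm
    clear e1 e2 htouch
    have hnew : (if j = (if k ∈ X then 2 * m - 1 - a else a) ∨
        j = (if k ∈ X then 2 * m - 1 - a else a) + 1 then (2 : ℤ) else 0) =
        if k ∈ X then 2 - (height (M.shape k.succ) j - height (M.shape k.castSucc) j)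
          else height (M.shape k.succ) j - height (M.shape k.castSucc) j := by
      rw [e0]
      by_cases hja : j = a ∨ j = a + 1
      · by_cases hk : k ∈ X
        · simp only [if_pos hk, if_pos hja]
          rw [if_neg (by omega)]
          omega
        · simp only [if_neg hk, if_pos hja]
          omega
      · by_cases hk : k ∈ X
        · simp only [if_pos hk, if_neg hja]
          rw [if_pos (by omega)]
          omega
        · simp only [if_neg hk, if_neg hja]
          omega
    rw [hnew]
    clear hnew e0
    clear ham hjm hj hm
    have hcs := hasCorner_iff (Y := M.shape k.castSucc) (j := j)
    have hsc := hasCorner_iff (Y := M.shape k.succ) (j := j)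
    have s1 := height_succ (M.shape k.castSucc) j
    have s2 := height_pred (M.shape k.castSucc) j
    have s3 := height_succ (M.shape k.succ) j
    have s4 := height_pred (M.shape k.succ) j
    -- Exactly one of the two shapes has a corner on `j`, and it is switched iff `k ∈ X`. This
    -- exchanges the increments 0 and 2.
    by_cases hc : HasCorner (M.shape k.castSucc) j
    · have hc' : ¬ HasCorner (M.shape k.succ) j := by
        rw [hsc]; rw [hcs] at hc
        omega
      rw [hX.mem_movedDiags_castSucc_iff htj hc hc',
        if_neg (mt hasCorner_of_mem_movedDiags hc')]
      rw [hsc] at hc'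
      rw [hcs] at hc
      by_cases hk : k ∈ X
      · simp only [if_pos hk]; omega
      · simp only [if_neg hk]; omega
    · have hc' : HasCorner (M.shape k.succ) j := by
        rw [hsc]; rw [hcs] at hc
        omega
      rw [hX.mem_movedDiags_succ_iff htj hc hc',
        if_neg (mt hasCorner_of_mem_movedDiags hc)]
      rw [hsc] at hc'
      rw [hcs] at hc
      by_cases hk : k ∈ X
      · simp only [if_pos hk]; omega
      · simp only [if_neg hk]; omega
  · have htj : ¬ M.Touches s k j := fun h => hjm (htouch.1 h).2
    rw [if_neg (by omega)] at e0 e1 e2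
    have hnew : ¬ (j = (if k ∈ X then 2 * m - 1 - a else a) ∨
        j = (if k ∈ X then 2 * m - 1 - a else a) + 1) := by
      split_ifs <;> omega
    rw [if_neg hnew]
    clear hnew
    have hcs := hasCorner_iff (Y := M.shape k.castSucc) (j := j)
    have hsc := hasCorner_iff (Y := M.shape k.succ) (j := j)
    have s1 := height_succ (M.shape k.castSucc) j
    have s2 := height_pred (M.shape k.castSucc) j
    have s3 := height_succ (M.shape k.succ) j
    have s4 := height_pred (M.shape k.succ) j
    -- Away from the domino nothing changes at `j` and its neighbours, so both shapes have a corner,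
    -- switched alike, or neither has.
    by_cases hc : HasCorner (M.shape k.castSucc) j
    · have hc' : HasCorner (M.shape k.succ) j := by
        rw [hsc]; rw [hcs] at hc
        omega
      rw [mem_movedDiags_castSucc_iff_succ htj hc hc']
      split_ifs <;> omega
    · have hc' : ¬ HasCorner (M.shape k.succ) j := by
        rw [hsc]; rw [hcs] at hc
        omega
      rw [if_neg (mt hasCorner_of_mem_movedDiags hc),
        if_neg (mt hasCorner_of_mem_movedDiags hc')]
      omega

/-! ### Geometry of semistandard domino tableaux -/

theorem exists_mem_domino_of_le {M : Filling n} {k l : Fin n} (hkl : k ≤ l) {x y z : ℕ × ℕ}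
    (hx : x ∈ M.domino k) (hy : y ∈ M.domino l) (hxz : x ≤ z) (hzy : z ≤ y) :
    ∃ d, k ≤ d ∧ d ≤ l ∧ z ∈ M.domino d := by
  classical
  rw [domino, Finset.mem_sdiff, YoungDiagram.mem_cells, YoungDiagram.mem_cells] at hx hy
  have hz : z ∈ M.shape l.succ := (M.shape l.succ).isLowerSet hzy hy.1
  have hz' : z ∉ M.shape k.castSucc := fun h => hx.2 ((M.shape k.castSucc).isLowerSet hxz h)
  have hex : ∃ d : Fin n, k ≤ d ∧ z ∈ M.shape d.succ := ⟨l, hkl, hz⟩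
  obtain ⟨d, ⟨hkd, hd⟩, hmin⟩ := WellFounded.has_min (wellFounded_lt (α := Fin n))
    {d : Fin n | k ≤ d ∧ z ∈ M.shape d.succ} hex
  refine ⟨d, hkd, not_lt.1 (hmin l ⟨hkl, hz⟩), ?_⟩
  rw [domino, Finset.mem_sdiff, YoungDiagram.mem_cells, YoungDiagram.mem_cells]
  refine ⟨hd, fun hcon => ?_⟩
  rcases hkd.lt_or_eq with hlt | rfl
  · have hlt' : (k : ℕ) < d := hlt
    have hd' : (⟨d - 1, by omega⟩ : Fin n).succ = d.castSucc := Fin.ext (by simp; omega)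
    refine hmin ⟨d - 1, by omega⟩ ⟨?_, ?_⟩ ?_
    · rw [Fin.le_def]; simp; omega
    · rw [hd']; exact hcon
    · rw [Fin.lt_def]; simp; omega
  · exact hz' hcon

namespace IsSemistandard

theorem monotone_shape {M : Filling n} (hM : M.IsSemistandard) : Monotone M.shape :=
  Fin.monotone_iff_le_succ.2 hM.le_step

theorem not_le_of_lt {M : Filling n} (hM : M.IsSemistandard)
    {k l : Fin n} (hkl : k < l) {x y : ℕ × ℕ} (hx : x ∈ M.domino k)
    (hy : y ∈ M.domino l) : ¬ y ≤ x := by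
  intro hyx
  rw [domino, Finset.mem_sdiff, YoungDiagram.mem_cells, YoungDiagram.mem_cells] at hx hy
  have hle : k.succ ≤ l.castSucc := by
    rw [Fin.le_def, Fin.val_succ, Fin.val_castSucc]; exact hkl
  exact hy.2 (hM.monotone_shape hle ((M.shape k.succ).isLowerSet hyx hx.1))

/-- The top row `t` of a domino, and what it says about the cells. -/
theorem exists_top {M : Filling n} (hM : M.IsSemistandard)
    (k : Fin n) : ∃ t : ℕ, (t, M.col k) ∈ M.domino k ∧
    (M.row k, M.col k) ∈ M.domino k ∧ pos (M.domino k) = 2 * ((M.col k : ℤ) - t) - 1 ∧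
    ∀ r c, (r, c) ∈ M.domino k → t ≤ r ∧ (c = M.col k ∨ (c + 1 = M.col k ∧ r = t)) := by
  obtain ⟨r, c, h | h⟩ := hM.isDomino k
  · have hc : M.col k = c + 1 := by rw [col, h]; simp
    have hr : M.row k = r := by rw [row, h]; simp
    refine ⟨r, ?_, ?_, ?_, ?_⟩
    · rw [hc, h]; simp
    · rw [hc, hr, h]; simp
    · rw [hc, h, pos, Finset.sum_pair (by simp)]
      simp only [content]; push_cast; ring
    · intro r' c' h'
      rw [h] at h'
      simp only [Finset.mem_insert, Finset.mem_singleton, Prod.mk.injEq] at h'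
      omega
  · have hc : M.col k = c := by rw [col, h]; simp
    have hr : M.row k = r + 1 := by rw [row, h]; simp
    refine ⟨r, ?_, ?_, ?_, ?_⟩
    · rw [hc, h]; simp
    · rw [hc, hr, h]; simp
    · rw [hc, h, pos, Finset.sum_pair (by simp)]
      simp only [content]; push_cast; ring
    · intro r' c' h'
      rw [h] at h'
      simp only [Finset.mem_insert, Finset.mem_singleton, Prod.mk.injEq] at h'
      omega

/-- A later domino cannot have a cell weakly northwest of an earlier one, so its top row must be
lower. -/
theorem pos_lt_of_col_le {M : Filling n} (hM : M.IsSemistandard)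
    {k l : Fin n} (hkl : k < l) (h : M.col l ≤ M.col k) :
    pos (M.domino l) < pos (M.domino k) := by
  obtain ⟨t, ht, -, hp, -⟩ := hM.exists_top k
  obtain ⟨u, hu, -, hq, -⟩ := hM.exists_top l
  have : t < u := by
    by_contra hcon
    exact hM.not_le_of_lt hkl ht hu (Prod.mk_le_mk.2 ⟨by omega, h⟩)
  omega

theorem col_lt_col {M : Filling n} (hM : M.IsSemistandard)
    {k l : Fin n} (hkl : k < l) (he : M.entry k = M.entry l) :
    M.col k < M.col l := by
  by_contra hcon
  exact absurd (hM.pos_lt_of_col_le hkl (by omega)) (hM.pos_lt k l hkl he).not_gt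

theorem row_le_row {M : Filling n} (hM : M.IsSemistandard)
    {k l : Fin n} (hkl : k < l) (h : M.col l = M.col k) : M.row k ≤ M.row l := by
  obtain ⟨t, -, ht, -⟩ := hM.exists_top k
  obtain ⟨u, -, hu, -⟩ := hM.exists_top l
  by_contra hcon
  exact hM.not_le_of_lt hkl ht hu (Prod.mk_le_mk.2 ⟨by omega, h.le⟩)

theorem lt_of_entry_lt {M : Filling n} (hM : M.IsSemistandard)
    {k l : Fin n} (h : M.entry k < M.entry l) : k < l := by
  by_contra hcon
  exact absurd (hM.entry_mono l k (not_lt.1 hcon)) h.not_ge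

/-- This handles the only discrepancy between reading by columns and by positions. The cell above
`l` in its rightmost column belongs to a domino `d` with the entry of `k`. If `d` stuck out to the
right, the domino on the cell above would have the same entry but not a smaller position. -/
theorem exists_col_eq {M : Filling n} (hM : M.IsSemistandard)
    {k l : Fin n} (he : M.entry l = M.entry k + 1) (hc : M.col k < M.col l)
    (hp : pos (M.domino l) < pos (M.domino k)) :
    ∃ d, M.entry d = M.entry k ∧ M.col d = M.col l := by
  have hkl : k < l := hM.lt_of_entry_lt (by omega)
  obtain ⟨t, ht, -, hpk, -⟩ := hM.exists_top k
  obtain ⟨u, hu, -, hpl, hul⟩ := hM.exists_top l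
  obtain ⟨d, hkd, hdl, hd⟩ := exists_mem_domino_of_le hkl.le (z := (u - 1, M.col l)) ht hu
    (Prod.mk_le_mk.2 ⟨by omega, by omega⟩) (Prod.mk_le_mk.2 ⟨by omega, by omega⟩)
  obtain ⟨v, hv, -, hpd, hvd⟩ := hM.exists_top d
  have hdc := hvd _ _ hd
  have hdl' : d ≠ l := by
    rintro rfl
    have := hul _ _ hd
    omega
  have e1 := hM.entry_mono _ _ hkd
  have e2 := hM.entry_mono _ _ hdl
  have hde : M.entry d ≠ M.entry l := fun h => by
    have := hM.col_lt_col (lt_of_le_of_ne hdl hdl') h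
    omega
  refine ⟨d, by omega, ?_⟩
  by_contra hcol
  -- The position inequality gives `u ≥ t + 2`, so row `u - 2` is still weakly below the top of `k`.
  obtain ⟨f, hkf, hfd, hf⟩ := exists_mem_domino_of_le hkd (z := (u - 2, M.col l)) ht hd
    (Prod.mk_le_mk.2 ⟨by omega, by omega⟩) (Prod.mk_le_mk.2 ⟨by omega, by omega⟩)
  obtain ⟨w, hw, -, hpf, hwf⟩ := hM.exists_top f
  have hfc := hwf _ _ hf
  have hfd' : f ≠ d := by
    rintro rfl
    have := hvd _ _ hf
    omega
  have e3 := hM.entry_mono _ _ hkf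
  have e4 := hM.entry_mono _ _ hfd
  have hlt := lt_of_le_of_ne hfd hfd'
  have h1 := hM.col_lt_col hlt (by omega)
  have h2 := hM.pos_lt _ _ hlt (by omega)
  omega

end IsSemistandard

/-! ### The lattice condition in terms of positions -/

open Classical in
/-- The lattice condition, read by decreasing position, at the position `p`: there are at most as
many entries `i + 1` at positions from `p` on as entries `i` at positions beyond `p`. -/
def PosLattice (M : Filling n) (i : ℕ) (p : ℤ) : Prop :=
  (Finset.univ.filter fun l : Fin n => M.entry l = i + 1 ∧ p ≤ pos (M.domino l)).card ≤
    (Finset.univ.filter fun l : Fin n => M.entry l = i ∧ p < pos (M.domino l)).card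

-- Read up to the first `i + 1` in the list at a position `≥ p`: each `i` read by then precedes it
-- in the list and lies weakly to its right, hence at a larger position.
open Classical in
theorem IsYamanouchi.posLattice {M : Filling n} (hM : M.IsYamanouchi) (i : ℕ) (p : ℤ) :
    M.PosLattice i p := by
  have hS := hM.isSemistandard
  rw [PosLattice]
  set R := Finset.univ.filter fun l : Fin n => M.entry l = i + 1 ∧ p ≤ pos (M.domino l) with hR
  rcases R.eq_empty_or_nonempty with h | h
  · rw [h]; simp
  have hB := R.min'_mem h
  have hmin := R.min'_le
  set B := R.min' h
  rw [hR, Finset.mem_filter] at hB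
  obtain ⟨-, hBe, hBp⟩ := hB
  refine le_trans (Finset.card_le_card ?_) ((hM.lattice B i).trans (Finset.card_le_card ?_))
  · intro l hl
    have hle := hmin l hl
    rw [hR, Finset.mem_filter] at hl
    rw [Finset.mem_filter]
    refine ⟨Finset.mem_univ _, ?_, hl.2.1⟩
    rcases hle.lt_or_eq with hlt | heq
    · exact Or.inl (hS.col_lt_col hlt (hBe.trans hl.2.1.symm))
    · rw [← heq]; exact Or.inr ⟨rfl, le_rfl⟩
  · intro l hl
    rw [Finset.mem_filter] at hl ⊢
    obtain ⟨-, hread, hle⟩ := hl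
    refine ⟨Finset.mem_univ _, hle, hBp.trans_lt (hS.pos_lt_of_col_le ?_ ?_)⟩
    · exact hS.lt_of_entry_lt (by omega)
    · rcases hread with h | h
      · exact h.le
      · exact h.1.ge

open Classical in
theorem IsSemistandard.card_le_of_posLattice {M : Filling n} (hM : M.IsSemistandard) {i : ℕ}
    (h : ∀ l, M.entry l = i + 1 → M.PosLattice i (pos (M.domino l))) :
    ∀ (N : ℕ) (l : Fin n), n ≤ l + N → M.entry l = i + 1 →
      (Finset.univ.filter fun b : Fin n => M.entry b = i + 1 ∧ l ≤ b).card ≤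
        (Finset.univ.filter fun b : Fin n => M.entry b = i ∧ M.col l ≤ M.col b).card := by
  intro N
  -- The induction runs from the last domino backwards; `N` bounds the number of dominoes from `l`
  -- on.
  induction N with
  | zero => intro l hl; omega
  | succ N ih =>
    intro l hN hl
    -- If some `i` has the column of `l`, pair it with `l` and pass to the next `i + 1`, which lies
    -- strictly further right. Otherwise `exists_col_eq` shows that every `i` beyond the position of
    -- `l` has column at least that of `l`.
    by_cases hd : ∃ d, M.entry d = i ∧ M.col d = M.col l
    · obtain ⟨d, hde, hdc⟩ := hd
      set R := Finset.univ.filter fun b : Fin n => M.entry b = i + 1 ∧ l ≤ b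
      set R' := Finset.univ.filter fun b : Fin n => M.entry b = i + 1 ∧ l < b with hR'
      have hRR : R = insert l R' := by
        ext b
        simp only [R, R', Finset.mem_filter, Finset.mem_univ, true_and, Finset.mem_insert]
        constructor
        · rintro ⟨h1, h2⟩
          exact h2.eq_or_lt.imp Eq.symm fun h3 => ⟨h1, h3⟩
        · rintro (rfl | ⟨h1, h2⟩)
          · exact ⟨hl, le_rfl⟩
          · exact ⟨h1, h2.le⟩
      rw [hRR, Finset.card_insert_of_notMem (by simp [R'])]
      set Q := Finset.univ.filter fun b : Fin n => M.entry b = i ∧ M.col l < M.col b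
      have hQ : Q.card + 1 ≤
          (Finset.univ.filter fun b : Fin n => M.entry b = i ∧ M.col l ≤ M.col b).card := by
        rw [← Finset.card_insert_of_notMem (a := d) (s := Q) (by simp [Q, hdc])]
        refine Finset.card_le_card fun b hb => ?_
        simp only [Q, Finset.mem_filter, Finset.mem_univ, true_and, Finset.mem_insert] at hb ⊢
        rcases hb with rfl | hb
        · exact ⟨hde, hdc.ge⟩
        · exact ⟨hb.1, hb.2.le⟩
      refine le_trans (Nat.succ_le_succ ?_) hQ
      rcases R'.eq_empty_or_nonempty with hE | hE
      · rw [hE]; simp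
      have hB := R'.min'_mem hE
      have hmin := R'.min'_le
      set B := R'.min' hE
      rw [hR', Finset.mem_filter] at hB
      obtain ⟨-, hBe, hlB⟩ := hB
      have hlB' : (l : ℕ) < B := hlB
      have hcol := hM.col_lt_col hlB (hl.trans hBe.symm)
      refine le_trans (Finset.card_le_card ?_) ((ih B (by omega) hBe).trans
        (Finset.card_le_card ?_))
      · intro b hb
        have hle := hmin b hb
        rw [hR', Finset.mem_filter] at hb
        exact Finset.mem_filter.2 ⟨Finset.mem_univ _, hb.2.1, hle⟩
      · intro b hb
        rw [Finset.mem_filter] at hb ⊢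
        exact ⟨Finset.mem_univ _, hb.2.1, by omega⟩
    · refine le_trans (Finset.card_le_card ?_) ((h l hl).trans (Finset.card_le_card ?_))
      · intro b hb
        rw [Finset.mem_filter] at hb ⊢
        refine ⟨Finset.mem_univ _, hb.2.1, ?_⟩
        rcases hb.2.2.lt_or_eq with hlt | heq
        · exact (hM.pos_lt _ _ hlt (hl.trans hb.2.1.symm)).le
        · rw [heq]
      · intro b hb
        rw [Finset.mem_filter] at hb ⊢
        refine ⟨Finset.mem_univ _, hb.2.1, ?_⟩
        by_contra hcon
        obtain ⟨d, h1, h2⟩ := hM.exists_col_eq (by omega) (not_le.1 hcon) hb.2.2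
        exact hd ⟨d, h1.trans hb.2.1, h2⟩

-- The first listed `i + 1` read up to `k` is the leftmost such one; an `i` in its column precedes
-- it in the list, so is not below it and is read as well.
open Classical in
theorem IsSemistandard.isYamanouchi {M : Filling n} (hM : M.IsSemistandard)
    (h : ∀ i l, M.entry l = i + 1 → M.PosLattice i (pos (M.domino l))) : M.IsYamanouchi := by
  refine ⟨hM, fun k i => ?_⟩
  rw [readCount, readCount]
  set R := Finset.univ.filter fun l : Fin n => M.ReadUpTo k l ∧ M.entry l = i + 1 with hR
  rcases R.eq_empty_or_nonempty with hE | hE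
  · rw [hE]; simp
  have hB := R.min'_mem hE
  have hmin := R.min'_le
  set B := R.min' hE
  rw [hR, Finset.mem_filter] at hB
  obtain ⟨-, hread, hBe⟩ := hB
  refine le_trans (Finset.card_le_card ?_)
    ((hM.card_le_of_posLattice (h i) n B (by omega) hBe).trans (Finset.card_le_card ?_))
  · intro l hl
    have hle := hmin l hl
    rw [hR, Finset.mem_filter] at hl
    exact Finset.mem_filter.2 ⟨Finset.mem_univ _, hl.2.2, hle⟩
  · intro l hl
    rw [Finset.mem_filter] at hl ⊢
    obtain ⟨-, hle, hc⟩ := hl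
    refine ⟨Finset.mem_univ _, ?_, hle⟩
    rcases hread with hr | ⟨hr, hr'⟩
    · exact Or.inl (by omega)
    · rcases hc.lt_or_eq with hlt | heq
      · exact Or.inl (by omega)
      · have := hM.row_le_row (hM.lt_of_entry_lt (k := l) (l := B) (by omega)) heq
        exact Or.inr ⟨by omega, by omega⟩

/-! ### Positions after a move, and the theorem -/

open Classical in
theorem IsSemistandard.exists_base {M : Filling n} (hM : M.IsSemistandard) (s : ZMod 2) :
    ∃ m : Fin n → ℤ, (∀ k, ¬ ((m k : ℤ) : ZMod 2) = s) ∧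
      (∀ k, pos (M.domino k) = 2 * m k + 1 ∨ pos (M.domino k) = 2 * m k - 1) ∧
      ∀ X, M.IsLinkClosed s X → ∀ k,
        (∃ a, IsDominoStep ((M.move s X).shape k.castSucc) ((M.move s X).shape k.succ) a) ∧
        pos ((M.move s X).domino k) =
          if k ∈ X then 4 * m k - pos (M.domino k) else pos (M.domino k) := by
  choose a ha using fun k => exists_isDominoStep (hM.le_step k) (hM.isDomino k)
  have hm : ∀ k, ∃ m : ℤ, ¬ (m : ZMod 2) = s ∧ (a k = m ∨ a k = m - 1) := by
    intro k
    obtain ⟨t, ht⟩ := exists_intCast_eq_iff s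
    simp only [ht]
    by_cases h : a k % 2 = t % 2
    · exact ⟨a k + 1, by omega, by omega⟩
    · exact ⟨a k, h, Or.inl rfl⟩
  choose m hms ham using hm
  have hpos : ∀ k, pos (M.domino k) = 2 * a k + 1 := fun k => (ha k).pos_sdiff
  refine ⟨m, hms, fun k => ?_, fun X hX k => ?_⟩
  · have := ham k
    rw [hpos]
    omega
  · have h := hX.isDominoStep_move (ha k) (hms k) (ham k)
    refine ⟨⟨_, h⟩, ?_⟩
    rw [domino, h.pos_sdiff, hpos]
    split_ifs <;> ring

end Filling

end DominoTab

open DominoTab Filling in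
theorem mainTheorem5 (n : ℕ) (M : DominoTab.Filling n) (hM : M.IsYamanouchi)
    (s : ZMod 2) (T : Set (Set (Fin n))) (hT : T ⊆ M.goodChains s) :
    (M.move s (⋃₀ T)).IsYamanouchi := by
  classical
  have hS := hM.isSemistandard
  obtain ⟨m, hms, hpm, hmove⟩ := hS.exists_base s
  have hTc : ∀ C ∈ T, M.IsLinkClosed s C := fun C hC => isLinkClosed_of_isChain (hT hC).1.1
  have hX := IsLinkClosed.sUnion hTc
  have hposC : ∀ C ∈ T, ∀ k, pos ((M.move s C).domino k) =
      if k ∈ C then 4 * m k - pos (M.domino k) else pos (M.domino k) :=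
    fun C hC k => (hmove C (hTc C hC) k).2
  have hposX := fun k => (hmove _ hX k).2
  have hsep : ∀ k l, k < l → M.entry k = M.entry l → m k = m l → k ∉ ⋃₀ T ∧ l ∉ ⋃₀ T := by
    intro k l hkl he hm
    have h0 := hS.pos_lt k l hkl he
    have hk := hpm k
    have hl := hpm l
    have key : ∀ C ∈ T, k ∉ C ∧ l ∉ C := by
      intro C hC
      have h1 := (hT hC).2.isSemistandard.pos_lt k l hkl he
      rw [hposC C hC, hposC C hC] at h1
      -- The positions are `2 * m k - 1` and `2 * m k + 1`; moving one domino makes them equal,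
      -- moving both reverses them.
      constructor <;> intro hmem <;> rw [if_pos hmem] at h1 <;> split_ifs at h1 <;> omega
    exact ⟨fun ⟨C, hC, h⟩ => (key C hC).1 h, fun ⟨C, hC, h⟩ => (key C hC).2 h⟩
  have hpX : ∀ k, pos ((M.move s (⋃₀ T)).domino k) = 2 * m k + 1 ∨
      pos ((M.move s (⋃₀ T)).domino k) = 2 * m k - 1 := by
    intro k
    have := hpm k
    rw [hposX]
    split_ifs <;> omega
  obtain ⟨t, ht⟩ := exists_intCast_eq_iff s
  simp only [ht] at hms
  have hSX : (M.move s (⋃₀ T)).IsSemistandard := by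
    refine ⟨fun k => ?_, fun k => ?_, hS.entry_mono, fun k l hkl he => ?_⟩
    · obtain ⟨a, ha⟩ := (hmove _ hX k).1
      exact ha.le
    · obtain ⟨a, ha⟩ := (hmove _ hX k).1
      exact ha.isDomino
    · have h0 := hS.pos_lt k l hkl he
      have hk := hpm k
      have hl := hpm l
      by_cases hm : m k = m l
      · obtain ⟨h1, h2⟩ := hsep k l hkl he hm
        rw [hposX, hposX, if_neg h1, if_neg h2]
        exact h0
      -- Distinct bases differ by at least 2, so the position ranges are disjoint.
      · have hk' := hpX k
        have hl' := hpX l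
        have hkp := hms k
        have hlp := hms l
        omega
  -- On the dominoes with a given entry and base, `⋃₀ T` acts like a single chain or not at all.
  have hagree : ∀ e m₀, ∃ N : Filling n, N.IsYamanouchi ∧ N.entry = M.entry ∧
      (∀ l, pos (N.domino l) = 2 * m l + 1 ∨ pos (N.domino l) = 2 * m l - 1) ∧
      ∀ l, M.entry l = e → m l = m₀ →
        pos (N.domino l) = pos ((M.move s (⋃₀ T)).domino l) := by
    intro e m₀
    by_cases hex : ∃ k ∈ ⋃₀ T, M.entry k = e ∧ m k = m₀
    · obtain ⟨k, ⟨C, hC, hkC⟩, hke, hkm⟩ := hex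
      refine ⟨M.move s C, (hT hC).2, rfl, fun l => ?_, fun l hle hlm => ?_⟩
      · have := hpm l
        rw [hposC C hC]
        split_ifs <;> omega
      · have hlk : l = k := by
          rcases lt_trichotomy l k with h | h | h
          · exact absurd ⟨C, hC, hkC⟩ (hsep l k h (hle.trans hke.symm) (hlm.trans hkm.symm)).2
          · exact h
          · exact absurd ⟨C, hC, hkC⟩ (hsep k l h (hke.trans hle.symm) (hkm.trans hlm.symm)).1
        subst hlk
        rw [hposC C hC, hposX, if_pos hkC, if_pos ⟨C, hC, hkC⟩]
    · refine ⟨M, hM, rfl, hpm, fun l hle hlm => ?_⟩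
      rw [hposX, if_neg fun h => hex ⟨l, h, hle, hlm⟩]
  refine hSX.isYamanouchi fun i b hb => ?_
  have hbp := hms b
  generalize hp : pos ((M.move s (⋃₀ T)).domino b) = p
  have hp' := hpX b
  rw [hp] at hp'
  rcases hp' with hp' | hp'
  -- At `p = 2 * m b + 1`, the entries `i` beyond `p` are those with base above `m b`, whatever is
  -- moved. Only the entries `i + 1` with base `m b` matter, and there `N` agrees.
  · obtain ⟨N, hN, hNe, hNp, hNa⟩ := hagree (i + 1) (m b)
    refine le_trans (Finset.card_le_card fun l hl => ?_)
      ((hN.posLattice i p).trans (Finset.card_le_card fun l hl => ?_))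
    · simp only [Finset.mem_filter, Finset.mem_univ, true_and] at hl ⊢
      have h1 := hNp l
      have h2 := hpX l
      have h3 := hNa l hl.1
      have h4 := hms l
      rw [hNe]
      exact ⟨hl.1, by omega⟩
    · simp only [Finset.mem_filter, Finset.mem_univ, true_and, hNe] at hl ⊢
      have h1 := hNp l
      have h2 := hpX l
      have h4 := hms l
      exact ⟨hl.1, by omega⟩
  -- At `p = 2 * m b - 1`, the entries `i + 1` from `p` on are those with base at least `m b`; now
  -- only the entries `i` with base `m b` matter.
  · obtain ⟨N, hN, hNe, hNp, hNa⟩ := hagree i (m b)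
    refine le_trans (Finset.card_le_card fun l hl => ?_)
      ((hN.posLattice i p).trans (Finset.card_le_card fun l hl => ?_))
    · simp only [Finset.mem_filter, Finset.mem_univ, true_and] at hl ⊢
      have h1 := hNp l
      have h2 := hpX l
      have h4 := hms l
      rw [hNe]
      exact ⟨hl.1, by omega⟩
    · simp only [Finset.mem_filter, Finset.mem_univ, true_and, hNe] at hl ⊢
      have h1 := hNp l
      have h2 := hpX l
      have h3 := hNa l hl.1
      have h4 := hms l
      exact ⟨hl.1, by omega⟩
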